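/- Let $k$ be a commutative domain and let $K$ be an abstract simplicial complex on a finite vertex set $V$ (the empty set is a face of $K$). Let $R=R_K=k[x_v: v\in V]/I_K$ be its Stanley-Reisner ring, where for a complex $L$ on $V$ the face ideal $I_L$ is the ideal generated by the monomials $\prod_{v\in s}x_v$ with $s\subseteq V$, $s\notin L$. Let $D(R)=\bigcup_{n\ge 0}D^n(R)\subseteq \mathrm{End}_k(R)$ be the ring of $k$-linear differential operators on $R$, where $D^0(R)=R$ and $D^{n+1}(R)=\{\varphi\in \mathrm{End}_k(R) : [\varphi,r]\in D^n(R)\text{ for all } r\in R\}$. For a face $\sigma\in K$ (including $\sigma=\varnothing$) let $st(\sigma)=\{\tau\in K:\tau\cup\sigma\in K\}$ be its closed star, let $I_{st(\sigma)}\subseteq R$ also denote the image in $R$ of the face ideal of $st(\sigma)$, and let $\overline{I_{st(\sigma)}}$ be the two-sided ideal of $D(R)$ generated by it. Let $\mathcal{L}$ be the smallest set of two-sided ideals of $D(R)$ that contains all $\overline{I_{st(\sigma)}}$, $\sigma\in K$, and is closed under sums $I+J$ and intersections $I\cap J$. Theorem. If $k$ is a field, then $\mathcal{L}$ is the set of all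 proper two-sided ideals of $D(R)$. For an arbitrary commutative domain $k$, $\mathcal{L}$ is the set of all proper two-sided ideals $I$ of $D(R)$ such that $D(R)/I$ is a torsion-free $k$-module (that is, $c\varphi\in I$ with $0\neq c\in k$, $\varphi\in D(R)$, implies $\varphi\in I$). -/

import Mathlib

namespace StanleyReisner

/-! ### Rings of differential operators -/

section DiffOps

variable (k R : Type*) [CommRing k] [CommRing R] [Algebra k R]

/-- The `k`-module `D_k^n(R)` of `k`-linear differential operators on `R` of order at most `n`:
`D_k^0(R) = R` (acting by multiplication), and `D_k^{n+1}(R)` consists of the `k`-linear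
endomorphisms `φ` of `R` with `[φ, r] ∈ D_k^n(R)` for all `r ∈ R`. -/
def diffOpsOfOrder : ℕ → Submodule k (Module.End k R)
  | 0 => LinearMap.range (Algebra.lmul k R).toLinearMap
  | n + 1 =>
    { carrier := {φ | ∀ r : R,
        φ * Algebra.lmul k R r - Algebra.lmul k R r * φ ∈ diffOpsOfOrder n}
      add_mem' := by
        intro φ ψ hφ hψ r
        have h := add_mem (hφ r) (hψ r)
        rwa [show φ * Algebra.lmul k R r - Algebra.lmul k R r * φ
            + (ψ * Algebra.lmul k R r - Algebra.lmul k R r * ψ)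
            = (φ + ψ) * Algebra.lmul k R r - Algebra.lmul k R r * (φ + ψ) by noncomm_ring] at h
      zero_mem' := by
        intro r
        simp
      smul_mem' := by
        intro c φ hφ r
        have h := (diffOpsOfOrder n).smul_mem c (hφ r)
        rwa [smul_sub, ← smul_mul_assoc, ← mul_smul_comm] at h }

variable {k R}

theorem mem_diffOpsOfOrder_zero {φ : Module.End k R} :
    φ ∈ diffOpsOfOrder k R 0 ↔ ∃ a : R, Algebra.lmul k R a = φ :=
  Iff.rfl

theorem mem_diffOpsOfOrder_succ {n : ℕ} {φ : Module.End k R} :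
    φ ∈ diffOpsOfOrder k R (n + 1) ↔
      ∀ r : R, φ * Algebra.lmul k R r - Algebra.lmul k R r * φ ∈ diffOpsOfOrder k R n :=
  Iff.rfl

theorem diffOpsOfOrder_le_succ (n : ℕ) :
    diffOpsOfOrder k R n ≤ diffOpsOfOrder k R (n + 1) := by
  induction n with
  | zero =>
    rintro _ ⟨a, rfl⟩ r
    have h : (Algebra.lmul k R) a * (Algebra.lmul k R) r
        - (Algebra.lmul k R) r * (Algebra.lmul k R) a = 0 := by
      rw [← map_mul, ← map_mul, mul_comm, sub_self]
    exact h ▸ zero_mem _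
  | succ n ih =>
    intro φ hφ r
    exact ih (hφ r)

theorem diffOpsOfOrder_mono : Monotone (diffOpsOfOrder k R) :=
  monotone_nat_of_le_succ diffOpsOfOrder_le_succ

theorem mul_mem_diffOpsOfOrder (N : ℕ) : ∀ (m n : ℕ), m + n = N → ∀ φ ψ : Module.End k R,
    φ ∈ diffOpsOfOrder k R m → ψ ∈ diffOpsOfOrder k R n → φ * ψ ∈ diffOpsOfOrder k R N := by
  induction N with
  | zero =>
    intro m n h φ ψ hφ hψ
    obtain ⟨rfl, rfl⟩ : m = 0 ∧ n = 0 := by omega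
    obtain ⟨a, rfl⟩ := mem_diffOpsOfOrder_zero.1 hφ
    obtain ⟨b, rfl⟩ := mem_diffOpsOfOrder_zero.1 hψ
    exact mem_diffOpsOfOrder_zero.2 ⟨a * b, map_mul _ _ _⟩
  | succ N ih =>
    intro m n h φ ψ hφ hψ r
    rw [show φ * ψ * Algebra.lmul k R r - Algebra.lmul k R r * (φ * ψ)
      = φ * (ψ * Algebra.lmul k R r - Algebra.lmul k R r * ψ)
        + (φ * Algebra.lmul k R r - Algebra.lmul k R r * φ) * ψ by
      rw [mul_sub, sub_mul]
      simp only [mul_assoc]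
      abel]
    apply add_mem
    · cases n with
      | zero =>
        have h0 : ψ * Algebra.lmul k R r - Algebra.lmul k R r * ψ = 0 := by
          obtain ⟨b, rfl⟩ := mem_diffOpsOfOrder_zero.1 hψ
          rw [← map_mul, ← map_mul, mul_comm, sub_self]
        rw [h0, mul_zero]
        exact zero_mem _
      | succ n => exact ih m n (by omega) _ _ hφ (hψ r)
    · cases m with
      | zero =>
        have h0 : φ * Algebra.lmul k R r - Algebra.lmul k R r * φ = 0 := by
          obtain ⟨b, rfl⟩ := mem_diffOpsOfOrder_zero.1 hφ
          rw [← map_mul, ← map_mul, mul_comm, sub_self]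
        rw [h0, zero_mul]
        exact zero_mem _
      | succ m => exact ih m n (by omega) _ _ (hφ r) hψ

variable (k R)

/-- The ring `D_k(R) = ⋃ₙ D_k^n(R)` of `k`-linear differential operators on `R`. -/
def DiffOps : Subalgebra k (Module.End k R) where
  carrier := {φ | ∃ n : ℕ, φ ∈ diffOpsOfOrder k R n}
  mul_mem' := by
    rintro φ ψ ⟨m, hm⟩ ⟨n, hn⟩
    exact ⟨m + n, mul_mem_diffOpsOfOrder _ m n rfl φ ψ hm hn⟩
  add_mem' := by
    rintro φ ψ ⟨m, hm⟩ ⟨n, hn⟩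
    exact ⟨max m n, add_mem (diffOpsOfOrder_mono (le_max_left m n) hm)
      (diffOpsOfOrder_mono (le_max_right m n) hn)⟩
  algebraMap_mem' := by
    intro c
    exact ⟨0, mem_diffOpsOfOrder_zero.2 ⟨algebraMap k R c, AlgHom.commutes _ c⟩⟩

/-- The inclusion `R = D_k^0(R) → D_k(R)`, sending `a` to multiplication by `a`. -/
def toDiffOps : R →ₐ[k] DiffOps k R :=
  (Algebra.lmul k R).codRestrict (DiffOps k R) fun a => ⟨0, mem_diffOpsOfOrder_zero.2 ⟨a, rfl⟩⟩

variable {R}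

/-- The extension of an ideal `J` of `R` to `D_k(R)`: the two-sided ideal generated by `J`. -/
def extension (J : Ideal R) : TwoSidedIdeal (DiffOps k R) :=
  TwoSidedIdeal.span (toDiffOps k R '' (J : Set R))

end DiffOps

/-! ### Face rings of simplicial complexes -/

section FaceRings

variable {V : Type*}

/-- The faces of a simplicial complex, where the empty set counts as a face of every complex
(Mathlib's complexes record the nonempty faces only). -/
def IsFace (K : PreAbstractSimplicialComplex V) (σ : Finset V) : Prop :=
  σ = ∅ ∨ σ ∈ K

/-- The closed star `st(σ, K) = {τ ∈ K | τ ∪ σ ∈ K}`, a subcomplex of `K`. -/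
def closedStar [DecidableEq V] (K : PreAbstractSimplicialComplex V) (σ : Finset V) :
    PreAbstractSimplicialComplex V where
  faces := {τ | τ ∈ K ∧ τ ∪ σ ∈ K}
  isRelLowerSet_faces := by
    rintro τ ⟨h1, h2⟩
    refine ⟨(K.isRelLowerSet_faces h1).1, fun ρ hρ hne => ⟨?_, ?_⟩⟩
    · exact (K.isRelLowerSet_faces h1).2 hρ hne
    · exact (K.isRelLowerSet_faces h2).2 (Finset.union_subset_union_left hρ)
        (hne.mono Finset.subset_union_left)

variable (k : Type*) [CommRing k]

/-- The face ideal `I_K ⊆ k[x_v : v ∈ V]`, generated by the square-free monomials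
`∏_{v ∈ s} x_v` for the non-faces `s` of `K`. -/
noncomputable def faceIdeal (K : PreAbstractSimplicialComplex V) : Ideal (MvPolynomial V k) :=
  Ideal.span {m | ∃ s : Finset V, ¬ IsFace K s ∧ m = ∏ v ∈ s, MvPolynomial.X v}

/-- The Stanley-Reisner ring (face ring) `R_K = k[x_v : v ∈ V] / I_K`. -/
abbrev FaceRing (K : PreAbstractSimplicialComplex V) : Type _ :=
  MvPolynomial V k ⧸ faceIdeal k K

/-- The face ideal `I_{st(σ, K)}`, as an ideal of `R_K`. -/
noncomputable def starIdeal [DecidableEq V] (K : PreAbstractSimplicialComplex V) (σ : Finset V) :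
    Ideal (FaceRing k K) :=
  (faceIdeal k (closedStar K σ)).map (Ideal.Quotient.mk (faceIdeal k K))

end FaceRings

end StanleyReisner

open StanleyReisner

/-! Write ∂^(e) for the divided-power derivatives. If y kills m, then a power of y kills φ(m) for
every differential operator φ. Hence x^b can occur in φ(x^a) only if st(supp b) ⊆ st(supp a)
(`starLE_of_coef_ne_zero`), and D(R) is spanned over k by the x^c ∂^(e) with st(supp c) ⊆ st(supp e)
(`mem_span_opsOver`). For a face σ, the monomials x^c with st(σ) ⊄ st(supp c) therefore span a
D(R)-stable ideal M_σ, and the operators with values in M_σ form a proper two-sided ideal P_σ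
(`stratumAnn`) with torsion-free quotient.

The main step, `diffOp_mem_of_not_le`: if D(R)/I is torsion-free and I ⊄ P_σ, then I contains every
x^c ∂^(e) with st(supp c) ⊆ st(σ). Repeated commutators yield an element of I outside P_σ that is
multiplication by some r modulo M_σ. After multiplying by x^σ the error lives on faces strictly
larger than σ and lies in I by induction, so I contains a nonzero polynomial. An alternating sum of
products sandwiching this polynomial isolates one coefficient times x^c ∂^(e)
(`sum_op_mul_mon_mul_op`); divided powers keep the binomial factor equal to 1, so the characteristic
plays no role.

Torsion-freeness is thus the same as saturation, and a saturated I is the intersection of the P_σ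
containing it (`IsSaturated.mem`); it is proper exactly when P_∅ is among them. The extension of
I_{st(F)} is saturated and lies in P_σ exactly when F ∪ σ is a face. It follows that P_σ is the sum
of these extensions over the faces F ⊇ σ, so every proper saturated ideal lies in the lattice.
Conversely, the proper saturated ideals form a sublattice containing the generators. Over a field
torsion-freeness is automatic. -/

namespace StanleyReisner

/-! ### Module structures on face rings

The module structures coming from the algebra structure are given priority over the equal ones
coming from the quotient structure. -/

noncomputable local instance (priority := high) faceRingAddCommGroup {k : Type*} [CommRing k] {V : Type*}
    (K : PreAbstractSimplicialComplex V) : AddCommGroup (FaceRing k K) :=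
  NonUnitalNonAssocRing.toAddCommGroup

noncomputable local instance (priority := high) faceRingAddCommMonoid {k : Type*} [CommRing k] {V : Type*}
    (K : PreAbstractSimplicialComplex V) : AddCommMonoid (FaceRing k K) :=
  NonUnitalNonAssocSemiring.toAddCommMonoid

noncomputable local instance (priority := high) faceRingSMul {k : Type*} [CommRing k] {V : Type*}
    (K : PreAbstractSimplicialComplex V) : SMul k (FaceRing k K) := Algebra.toSMul

noncomputable local instance (priority := high) faceRingModule {k : Type*} [CommRing k] {V : Type*}
    (K : PreAbstractSimplicialComplex V) : Module k (FaceRing k K) := Algebra.toModule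

/-! ### Faces and closed stars -/

section Faces

variable {V : Type*} {K : PreAbstractSimplicialComplex V}

theorem isFace_empty : IsFace K ∅ := Or.inl rfl

theorem IsFace.mono {σ τ : Finset V} (h : IsFace K σ) (hτ : τ ⊆ σ) : IsFace K τ := by
  rcases τ.eq_empty_or_nonempty with h0 | h0
  · exact Or.inl h0
  · rcases h with rfl | h
    · exact Or.inl (Finset.subset_empty.1 hτ)
    · exact Or.inr ((K.isRelLowerSet_faces h).2 hτ h0)

variable [DecidableEq V]

theorem isFace_closedStar {σ τ : Finset V} (hσ : IsFace K σ) :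
    IsFace (closedStar K σ) τ ↔ IsFace K (τ ∪ σ) := by
  rcases τ.eq_empty_or_nonempty with rfl | h0
  · simp [hσ, isFace_empty]
  · have h1 : τ ≠ ∅ := h0.ne_empty
    have h2 : τ ∪ σ ≠ ∅ := (h0.mono Finset.subset_union_left).ne_empty
    constructor
    · rintro (h | h)
      · exact absurd h h1
      · exact Or.inr h.2
    · intro h
      refine Or.inr ⟨?_, h.resolve_left h2⟩
      exact (h.mono Finset.subset_union_left).resolve_left h1

variable (K) in
/-- The closed star of `σ` is contained in the closed star of `τ`. -/
def StarLE (σ τ : Finset V) : Prop := ∀ ρ, IsFace K (ρ ∪ σ) → IsFace K (ρ ∪ τ)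

theorem StarLE.refl (σ : Finset V) : StarLE K σ σ := fun _ h => h

theorem StarLE.trans {σ τ υ : Finset V} (h₁ : StarLE K σ τ) (h₂ : StarLE K τ υ) : StarLE K σ υ :=
  fun ρ h => h₂ ρ (h₁ ρ h)

theorem StarLE.of_subset {σ τ : Finset V} (h : τ ⊆ σ) : StarLE K σ τ :=
  fun _ hρ => hρ.mono (Finset.union_subset_union_right h)

/-- Applying the first hypothesis to ρ ∪ σ adjoins τ while keeping σ, so the second can still be
applied. -/
theorem StarLE.union {σ τ υ : Finset V} (h₁ : StarLE K σ τ) (h₂ : StarLE K σ υ) :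
    StarLE K σ (τ ∪ υ) := by
  intro ρ h
  have h3 : IsFace K ((ρ ∪ σ) ∪ τ) := by
    rw [Finset.union_right_comm]
    have := h₁ (ρ ∪ σ) (by rwa [Finset.union_assoc, Finset.union_self])
    rwa [Finset.union_right_comm] at this
  have h4 := h₂ (ρ ∪ τ) (by rwa [Finset.union_right_comm])
  rwa [Finset.union_assoc] at h4

theorem StarLE.isFace {σ τ : Finset V} (h : StarLE K σ τ) (hσ : IsFace K σ) : IsFace K (σ ∪ τ) :=
  h σ (by rwa [Finset.union_self])

end Faces

/-! ### Monomials and coefficients -/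

section Monomials

open MvPolynomial

variable {k : Type*} [CommRing k] {V : Type*} (K : PreAbstractSimplicialComplex V)

/-- The ideal is generated by monomials, so membership is tested termwise; non-faces are closed
under supersets, so only the support of an exponent matters. -/
theorem mem_faceIdeal {p : MvPolynomial V k} :
    p ∈ faceIdeal k K ↔ ∀ a ∈ p.support, ¬ IsFace K a.support := by
  classical
  have h : {m : MvPolynomial V k | ∃ s : Finset V, ¬ IsFace K s ∧ m = ∏ v ∈ s, X v} =
      (fun a => monomial a (1 : k)) '' {a | ∃ s : Finset V, ¬ IsFace K s ∧
        a = ∑ v ∈ s, Finsupp.single v 1} := by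
    ext m
    simp only [Set.mem_ofPred_eq, Set.mem_image]
    constructor
    · rintro ⟨s, hs, rfl⟩
      exact ⟨_, ⟨s, hs, rfl⟩, by rw [monomial_sum_one]; rfl⟩
    · rintro ⟨_, ⟨s, hs, rfl⟩, rfl⟩
      exact ⟨s, hs, by rw [monomial_sum_one]; rfl⟩
  have h1 : ∀ (s : Finset V) (w : V), (∑ v ∈ s, Finsupp.single v 1 : V →₀ ℕ) w =
      if w ∈ s then 1 else 0 := by
    intro s w
    rw [Finsupp.finsetSum_apply]
    simp [Finsupp.single_apply]
  rw [faceIdeal, h, mem_ideal_span_monomial_image]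
  refine forall₂_congr fun a _ => ?_
  constructor
  · rintro ⟨_, ⟨s, hs, rfl⟩, hle⟩ hf
    refine hs (hf.mono fun v hv => ?_)
    have := hle v
    rw [h1, if_pos hv] at this
    exact Finsupp.mem_support_iff.2 (by omega)
  · intro hf
    refine ⟨_, ⟨a.support, hf, rfl⟩, fun v => ?_⟩
    rw [h1]
    split_ifs with hv
    · exact Nat.one_le_iff_ne_zero.2 (Finsupp.mem_support_iff.1 hv)
    · exact Nat.zero_le _

variable (k) in
/-- The class of the monomial `x ^ a` in the face ring. -/
noncomputable def mon (a : V →₀ ℕ) : FaceRing k K :=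
  Ideal.Quotient.mk (faceIdeal k K) (monomial a 1)

theorem mon_add (a b : V →₀ ℕ) : mon k K (a + b) = mon k K a * mon k K b := by
  rw [mon, mon, mon, ← map_mul, monomial_mul, one_mul]

theorem mon_zero : mon k K 0 = 1 := by
  rw [mon, monomial_zero', C_1, map_one]

theorem mk_monomial (a : V →₀ ℕ) (c : k) :
    Ideal.Quotient.mk (faceIdeal k K) (monomial a c) = c • mon k K a := by
  have h : monomial a c = C c * monomial a (1 : k) := by rw [C_mul_monomial, mul_one]
  rw [h, map_mul, Algebra.smul_def]
  rfl

variable {K}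

theorem mon_eq_zero {a : V →₀ ℕ} (h : ¬ IsFace K a.support) : mon k K a = 0 := by
  classical
  refine Ideal.Quotient.eq_zero_iff_mem.2 ((mem_faceIdeal K).2 fun b hb => ?_)
  have := Finset.mem_singleton.1 (support_monomial_subset hb)
  rwa [this]

theorem mon_induction {p : FaceRing k K → Prop} (r : FaceRing k K)
    (mon : ∀ a, p (mon k K a)) (add : ∀ r s, p r → p s → p (r + s))
    (smul : ∀ (c : k) r, p r → p (c • r)) : p r := by
  obtain ⟨f, rfl⟩ := Ideal.Quotient.mk_surjective r
  induction f using MvPolynomial.induction_on' with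
  | monomial a c => rw [mk_monomial]; exact smul _ _ (mon a)
  | add f g hf hg => rw [map_add]; exact add _ _ hf hg

theorem end_ext {M : Type*} [AddCommGroup M] [Module k M] {φ ψ : FaceRing k K →ₗ[k] M}
    (h : ∀ a : V →₀ ℕ, IsFace K a.support → φ (mon k K a) = ψ (mon k K a)) : φ = ψ := by
  refine LinearMap.ext fun r => ?_
  induction r using mon_induction with
  | mon a =>
    by_cases ha : IsFace K a.support
    · exact h a ha
    · rw [mon_eq_zero ha, map_zero, map_zero]
  | add r s hr hs => rw [map_add, map_add, hr, hs]
  | smul c r hr => rw [map_smul, map_smul, hr]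

/-- A linear map on polynomials killing the face ideal descends to the face ring. -/
noncomputable def descend {M : Type*} [AddCommGroup M] [Module k M] (f : MvPolynomial V k →ₗ[k] M)
    (hf : (faceIdeal k K).restrictScalars k ≤ LinearMap.ker f) : FaceRing k K →ₗ[k] M :=
  ((faceIdeal k K).restrictScalars k).liftQ f hf ∘ₗ
    (Submodule.Quotient.restrictScalarsEquiv k (faceIdeal k K)).symm.toLinearMap

theorem descend_mk {M : Type*} [AddCommGroup M] [Module k M] (f : MvPolynomial V k →ₗ[k] M)
    (hf : (faceIdeal k K).restrictScalars k ≤ LinearMap.ker f) (p : MvPolynomial V k) :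
    descend f hf (Ideal.Quotient.mk (faceIdeal k K) p) = f p := rfl

theorem faceIdeal_le_ker {M : Type*} [AddCommGroup M] [Module k M] {f : MvPolynomial V k →ₗ[k] M}
    (h : ∀ a : V →₀ ℕ, ¬ IsFace K a.support → f (monomial a 1) = 0) :
    (faceIdeal k K).restrictScalars k ≤ LinearMap.ker f := by
  intro p hp
  have hp' := (mem_faceIdeal K).1 hp
  rw [LinearMap.mem_ker, ← support_sum_monomial_coeff p, map_sum]
  refine Finset.sum_eq_zero fun a ha => ?_
  have : monomial a (p.coeff a) = p.coeff a • monomial a (1 : k) := by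
    rw [smul_monomial, smul_eq_mul, mul_one]
  rw [this, map_smul, h a (hp' a ha), smul_zero]

open Classical in
/-- The coefficient of `x ^ b` in an element of the face ring (zero if `b` is not supported on
a face). -/
noncomputable def coef (b : V →₀ ℕ) : FaceRing k K →ₗ[k] k :=
  if h : IsFace K b.support then
    descend (lcoeff k b) (faceIdeal_le_ker fun a ha => by
      rw [lcoeff_apply, coeff_monomial, if_neg (by rintro rfl; exact ha h)])
  else 0

theorem coef_mk {b : V →₀ ℕ} (h : IsFace K b.support) (p : MvPolynomial V k) :
    coef b (Ideal.Quotient.mk (faceIdeal k K) p) = p.coeff b := by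
  rw [coef, dif_pos h]
  rfl

theorem coef_of_not_isFace {b : V →₀ ℕ} (h : ¬ IsFace K b.support) (r : FaceRing k K) :
    coef b r = 0 := by
  rw [coef, dif_neg h]
  rfl

theorem isFace_of_coef_ne_zero {b : V →₀ ℕ} {r : FaceRing k K} (h : coef b r ≠ 0) :
    IsFace K b.support :=
  not_not.1 fun h' => h (coef_of_not_isFace h' r)

theorem coef_mon_self {a : V →₀ ℕ} (h : IsFace K a.support) : coef a (mon k K a) = 1 := by
  classical
  rw [mon, coef_mk h, coeff_monomial, if_pos rfl]

theorem coef_mon_ne {a b : V →₀ ℕ} (h : a ≠ b) : coef b (mon k K a) = 0 := by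
  by_cases hb : IsFace K b.support
  · classical
    rw [mon, coef_mk hb, coeff_monomial, if_neg h]
  · exact coef_of_not_isFace hb _

theorem coef_mon_mul {b d : V →₀ ℕ} (h : IsFace K (d + b).support) (r : FaceRing k K) :
    coef (d + b) (mon k K d * r) = coef b r := by
  classical
  obtain ⟨p, rfl⟩ := Ideal.Quotient.mk_surjective r
  have hb : IsFace K b.support := h.mono (fun v hv => by
    simp only [Finsupp.mem_support_iff, Finsupp.add_apply] at *
    omega)
  rw [mon, ← map_mul, coef_mk h, coef_mk hb, coeff_monomial_mul, one_mul]

theorem coef_mon_mul_ne_zero {c d : V →₀ ℕ} {r : FaceRing k K} (h : coef c (mon k K d * r) ≠ 0) :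
    ∃ b, c = d + b ∧ coef b r ≠ 0 := by
  classical
  have hc := isFace_of_coef_ne_zero h
  have hdc : d ≤ c := by
    by_contra hdc
    apply h
    obtain ⟨p, rfl⟩ := Ideal.Quotient.mk_surjective r
    rw [mon, ← map_mul, coef_mk hc, coeff_monomial_mul', if_neg hdc]
  obtain ⟨b, rfl⟩ := exists_add_of_le hdc
  exact ⟨b, rfl, by rwa [coef_mon_mul hc] at h⟩

theorem exists_eq_sum_mon (r : FaceRing k K) :
    ∃ s : Finset (V →₀ ℕ), (∀ b, coef b r ≠ 0 → b ∈ s) ∧ r = ∑ b ∈ s, coef b r • mon k K b := by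
  obtain ⟨p, rfl⟩ := Ideal.Quotient.mk_surjective r
  refine ⟨p.support, fun b hb => ?_, ?_⟩
  · rw [coef_mk (isFace_of_coef_ne_zero hb)] at hb
    exact mem_support_iff.2 hb
  · conv_lhs => rw [← support_sum_monomial_coeff p, map_sum]
    refine Finset.sum_congr rfl fun b _ => ?_
    rw [mk_monomial]
    by_cases hb : IsFace K b.support
    · rw [coef_mk hb]
    · rw [mon_eq_zero hb, smul_zero, smul_zero]

theorem eq_zero_of_coef {r : FaceRing k K} (h : ∀ b, coef b r = 0) : r = 0 := by
  obtain ⟨s, -, hs⟩ := exists_eq_sum_mon r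
  rw [hs]
  exact Finset.sum_eq_zero fun b _ => by rw [h, zero_smul]

theorem support_add_eq_union [DecidableEq V] (a b : V →₀ ℕ) :
    (a + b).support = a.support ∪ b.support := by
  ext v
  simp only [Finsupp.mem_support_iff, Finsupp.add_apply, Finset.mem_union]
  omega

theorem starLE_zero [DecidableEq V] (c : V →₀ ℕ) : StarLE K c.support (0 : V →₀ ℕ).support :=
  StarLE.of_subset (by simp)

end Monomials

/-! ### General facts on differential operators -/

section DiffOps

variable {k R : Type*} [CommRing k] [CommRing R] [Algebra k R]

/-- Since y m = 0, the commutator [φ, y] sends m to -y φ(m); it has smaller order, so each drop in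
order costs one factor y. -/
theorem diffOps_apply_mul_eq_zero (n : ℕ) : ∀ φ ∈ diffOpsOfOrder k R n, ∀ y m : R, y * m = 0 →
    y ^ (n + 1) * φ m = 0 := by
  induction n with
  | zero =>
    rintro _ ⟨r, rfl⟩ y m h
    change y ^ (0 + 1) * (r * m) = 0
    rw [zero_add, pow_one, mul_left_comm, h, mul_zero]
  | succ n ih =>
    intro φ hφ y m h
    have h1 := ih _ (hφ y) y m h
    change y ^ (n + 1) * (φ (y * m) - y * φ m) = 0 at h1
    rw [h, map_zero, zero_sub, mul_neg, neg_eq_zero] at h1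
    rw [pow_succ, mul_assoc, h1]

theorem lmul_mul_mem_diffOpsOfOrder {n : ℕ} {φ : Module.End k R} (hφ : φ ∈ diffOpsOfOrder k R n)
    (r : R) : Algebra.lmul k R r * φ ∈ diffOpsOfOrder k R n :=
  mul_mem_diffOpsOfOrder n 0 n (zero_add n) _ _ ⟨r, rfl⟩ hφ

theorem mul_lmul_mem_diffOpsOfOrder {n : ℕ} {φ : Module.End k R} (hφ : φ ∈ diffOpsOfOrder k R n)
    (r : R) : φ * Algebra.lmul k R r ∈ diffOpsOfOrder k R n :=
  mul_mem_diffOpsOfOrder n n 0 (add_zero n) _ _ hφ ⟨r, rfl⟩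

/-- The order of an operator can be tested on commutators with algebra generators. -/
theorem mem_diffOpsOfOrder_succ_of_adjoin {n : ℕ} {φ : Module.End k R} {s : Set R}
    (hs : Algebra.adjoin k s = ⊤)
    (h : ∀ r ∈ s, φ * Algebra.lmul k R r - Algebra.lmul k R r * φ ∈ diffOpsOfOrder k R n) :
    φ ∈ diffOpsOfOrder k R (n + 1) := by
  intro r
  have hr : r ∈ Algebra.adjoin k s := hs ▸ Algebra.mem_top
  induction hr using Algebra.adjoin_induction with
  | mem r hr => exact h r hr
  | algebraMap c =>
    rw [AlgHom.commutes, Algebra.commutes, sub_self]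
    exact zero_mem _
  | add r t _ _ hr ht =>
    rw [map_add, mul_add, add_mul, add_sub_add_comm]
    exact add_mem hr ht
  | mul r t _ _ hr ht =>
    have : φ * Algebra.lmul k R (r * t) - Algebra.lmul k R (r * t) * φ =
        (φ * Algebra.lmul k R r - Algebra.lmul k R r * φ) * Algebra.lmul k R t +
        Algebra.lmul k R r * (φ * Algebra.lmul k R t - Algebra.lmul k R t * φ) := by
      rw [map_mul, sub_mul, mul_sub]
      simp only [mul_assoc]
      abel
    rw [this]
    exact add_mem (mul_lmul_mem_diffOpsOfOrder hr t) (lmul_mul_mem_diffOpsOfOrder ht r)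

end DiffOps

/-! ### Differential operators on a face ring and their values on monomials -/

section DiffOpsFaceRing

variable {k : Type*} [CommRing k] {V : Type*} {K : PreAbstractSimplicialComplex V}

theorem adjoin_mon_single :
    Algebra.adjoin k (Set.range fun v => mon k K (Finsupp.single v 1)) = ⊤ := by
  have h : (Set.range fun v => mon k K (Finsupp.single v 1)) =
      Ideal.Quotient.mkₐ k (faceIdeal k K) '' Set.range MvPolynomial.X := by
    rw [← Set.range_comp]
    rfl
  rw [h, ← AlgHom.map_adjoin, MvPolynomial.adjoin_range_X, Algebra.map_top,
    AlgHom.range_eq_top]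
  exact Ideal.Quotient.mkₐ_surjective _ _

/-- Differential operators do not shrink closed stars of supports. -/
theorem starLE_of_coef_ne_zero [DecidableEq V] {φ : Module.End k (FaceRing k K)}
    (hφ : φ ∈ DiffOps k (FaceRing k K)) {a b : V →₀ ℕ} (h : coef b (φ (mon k K a)) ≠ 0) :
    StarLE K b.support a.support := by
  intro ρ hρ
  obtain ⟨n, hn⟩ := hφ
  by_contra hρa
  set d : V →₀ ℕ := ∑ v ∈ ρ, Finsupp.single v 1
  have hd : d.support = ρ := by
    ext w
    rw [Finsupp.mem_support_iff, Finsupp.finsetSum_apply]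
    simp [Finsupp.single_apply]
  have hd' : ∀ m : ℕ, mon k K d ^ m = mon k K (m • d) := by
    intro m
    induction m with
    | zero => rw [pow_zero, zero_smul, mon_zero]
    | succ m ih => rw [pow_succ, ih, succ_nsmul, mon_add]
  have h0 : mon k K d * mon k K a = 0 := by
    rw [← mon_add]
    exact mon_eq_zero (by rwa [support_add_eq_union, hd])
  have h1 := diffOps_apply_mul_eq_zero n φ hn _ _ h0
  rw [hd'] at h1
  refine h ?_
  -- Multiplication by x^((n+1)d) merely shifts the exponent b, because the shifted exponent has
  -- support ρ ∪ supp b, a face.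
  rw [← coef_mon_mul (d := (n + 1) • d), h1, map_zero]
  rw [support_add_eq_union, Finsupp.support_smul_eq n.succ_ne_zero, hd]
  exact hρ

theorem exponent_induction {p : (V →₀ ℕ) → Prop} (a : V →₀ ℕ) (zero : p 0)
    (single_add : ∀ v a, p a → p (Finsupp.single v 1 + a)) : p a := by
  suffices h : ∀ b, p b → p (a + b) by simpa using h 0 zero
  induction a using Finsupp.induction_linear with
  | zero => intro b hb; rwa [zero_add]
  | add a a' ha ha' => intro b hb; rw [add_assoc]; exact ha _ (ha' _ hb)
  | single v m =>
    induction m with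
    | zero => intro b hb; rwa [Finsupp.single_zero, zero_add]
    | succ m ih =>
      intro b hb
      rw [add_comm m 1, Finsupp.single_add, add_assoc]
      exact single_add _ _ (ih b hb)

/-- An operator commuting with the variables modulo an ideal `J` is a multiplication
modulo `J`. -/
theorem apply_mon_sub_mem {φ : Module.End k (FaceRing k K)} (J : Ideal (FaceRing k K))
    (h : ∀ v r, φ (mon k K (Finsupp.single v 1) * r) - mon k K (Finsupp.single v 1) * φ r ∈ J)
    (a : V →₀ ℕ) : φ (mon k K a) - mon k K a * φ 1 ∈ J := by
  induction a using exponent_induction with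
  | zero => rw [mon_zero, one_mul, sub_self]; exact zero_mem _
  | single_add v a ih =>
    have := add_mem (h v (mon k K a)) (J.mul_mem_left (mon k K (Finsupp.single v 1)) ih)
    rwa [mul_sub, sub_add_sub_cancel, ← mul_assoc, ← mon_add] at this

/-- An operator of order at most `n` is determined by its values on monomials of degree at most
`n`. -/
theorem eq_zero_of_mon_degree_le (n : ℕ) : ∀ φ ∈ diffOpsOfOrder k (FaceRing k K) n,
    (∀ a : V →₀ ℕ, a.degree ≤ n → φ (mon k K a) = 0) → φ = 0 := by
  induction n with
  | zero =>
    rintro _ ⟨r, rfl⟩ h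
    have := h 0 (by simp)
    change r * mon k K 0 = 0 at this
    rw [mon_zero, mul_one] at this
    rw [this, map_zero]
  | succ n ih =>
    intro φ hφ h
    -- The commutators with variables vanish by induction, so φ is multiplication by φ(1) = 0.
    have hcomm : ∀ v, φ * Algebra.lmul k _ (mon k K (Finsupp.single v 1)) -
        Algebra.lmul k _ (mon k K (Finsupp.single v 1)) * φ = 0 := by
      intro v
      refine ih _ (hφ _) fun a ha => ?_
      change φ (mon k K (Finsupp.single v 1) * mon k K a) -
        mon k K (Finsupp.single v 1) * φ (mon k K a) = 0
      rw [← mon_add, h a (by omega), h _ (by rw [map_add, Finsupp.degree_single]; omega), mul_zero,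
        sub_zero]
    refine end_ext fun a _ => ?_
    have h1 := apply_mon_sub_mem (φ := φ) ⊥ (fun v r => by
      rw [Submodule.mem_bot]
      exact LinearMap.congr_fun (hcomm v) r) a
    have h0 := h 0 (by simp)
    rw [mon_zero] at h0
    rwa [Submodule.mem_bot, h0, mul_zero, sub_zero] at h1

end DiffOpsFaceRing


/-! ### Multi-index binomial coefficients -/

section Binomials

variable {V : Type*} [Fintype V]

/-- The multi-index binomial coefficient. -/
def multichoose (a e : V →₀ ℕ) : ℕ := ∏ v, (a v).choose (e v)

theorem multichoose_eq_zero {a e : V →₀ ℕ} (h : ¬ e ≤ a) : multichoose a e = 0 := by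
  obtain ⟨v, hv⟩ := not_forall.1 h
  exact Finset.prod_eq_zero (Finset.mem_univ v) (Nat.choose_eq_zero_of_lt (not_le.1 hv))

theorem multichoose_self (a : V →₀ ℕ) : multichoose a a = 1 :=
  Finset.prod_eq_one fun _ _ => Nat.choose_self _

theorem multichoose_zero (a : V →₀ ℕ) : multichoose a 0 = 1 :=
  Finset.prod_eq_one fun _ _ => Nat.choose_zero_right _

theorem multichoose_single_add_of_eq_zero {a e : V →₀ ℕ} {v : V} (h : e v = 0) :
    multichoose (Finsupp.single v 1 + a) e = multichoose a e := by
  classical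
  refine Finset.prod_congr rfl fun w _ => ?_
  rw [Finsupp.add_apply, Finsupp.single_apply]
  split_ifs with hw
  · rw [← hw, h, Nat.choose_zero_right, Nat.choose_zero_right]
  · rw [zero_add]

theorem multichoose_single_add_single_add (a e : V →₀ ℕ) (v : V) :
    multichoose (Finsupp.single v 1 + a) (Finsupp.single v 1 + e) =
      multichoose a e + multichoose a (Finsupp.single v 1 + e) := by
  classical
  have h : ∀ b d : V →₀ ℕ, multichoose b d =
      (b v).choose (d v) * ∏ w ∈ Finset.univ.erase v, (b w).choose (d w) := fun b d =>
    (Finset.mul_prod_erase _ _ (Finset.mem_univ v)).symm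
  have h1 : ∀ (b : V →₀ ℕ), ∀ w ∈ Finset.univ.erase v, (Finsupp.single v 1 + b : V →₀ ℕ) w = b w := by
    intro b w hw
    rw [Finsupp.add_apply, Finsupp.single_eq_of_ne (Finset.ne_of_mem_erase hw), zero_add]
  rw [h, h, h a (_ + e)]
  rw [Finset.prod_congr (g := fun w => (a w).choose (e w)) rfl fun w hw => by
      rw [h1 a w hw, h1 e w hw],
    Finset.prod_congr (f := fun w => (a w).choose ((Finsupp.single v 1 + e : V →₀ ℕ) w))
      (g := fun w => (a w).choose (e w)) rfl fun w hw => by rw [h1 e w hw]]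
  simp only [Finsupp.add_apply, Finsupp.single_eq_same]
  rw [add_comm 1 (a v), add_comm 1 (e v), Nat.choose_succ_succ, add_mul]

/-- Trinomial revision, coordinate by coordinate. It pulls a factor independent of j out of the
alternating sum in `sum_op_mul_mon_mul_op`. -/
theorem multichoose_mul (e a j : V →₀ ℕ) :
    multichoose (e + a) (e + j) * multichoose (e + j) e =
      multichoose (e + a) e * multichoose a j := by
  simp only [multichoose, ← Finset.prod_mul_distrib]
  refine Finset.prod_congr rfl fun v _ => ?_
  rw [Finsupp.add_apply, Finsupp.add_apply]
  by_cases h : j v ≤ a v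
  · rw [Nat.choose_mul (Nat.le_add_right _ _), Nat.add_sub_cancel_left, Nat.add_sub_cancel_left]
  · rw [Nat.choose_eq_zero_of_lt (by omega : e v + a v < e v + j v),
      Nat.choose_eq_zero_of_lt (by omega : a v < j v), zero_mul, mul_zero]

/-- Both sides are the coefficient of t^b in ((1 + t) - t)^A (1 + t)^s = (1 + t)^s. The induction on
A uses Pascal's rule; the truncation in `A - j` is harmless, as the binomial vanishes for j > A. -/
theorem sum_alternating_choose_mul_choose (A : ℕ) : ∀ s b : ℕ,
    ∑ j ∈ Finset.range (b + 1), (-1 : ℤ) ^ j * (A.choose j * (A - j + s).choose (b - j) : ℕ) =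
      (s.choose b : ℕ) := by
  induction A with
  | zero =>
    intro s b
    rw [Finset.sum_eq_single 0]
    · simp
    · intro j _ hj
      rw [Nat.choose_eq_zero_of_lt (Nat.pos_of_ne_zero hj), zero_mul, Nat.cast_zero, mul_zero]
    · simp
  | succ A ih =>
    intro s b
    cases b with
    | zero => simp
    | succ b =>
      have h1 := ih (s + 1) (b + 1)
      have h2 := ih s b
      rw [Finset.sum_range_succ'] at h1 ⊢
      have h3 : ∀ j ∈ Finset.range (b + 1), (-1 : ℤ) ^ (j + 1) *
          ((A + 1).choose (j + 1) * (A + 1 - (j + 1) + s).choose (b + 1 - (j + 1)) : ℕ) =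
          (-1 : ℤ) ^ (j + 1) * (A.choose (j + 1) *
            (A - (j + 1) + (s + 1)).choose (b + 1 - (j + 1)) : ℕ) -
          (-1 : ℤ) ^ j * (A.choose j * (A - j + s).choose (b - j) : ℕ) := by
        intro j _
        rw [Nat.choose_succ_succ, Nat.add_sub_add_right, Nat.add_sub_add_right]
        by_cases hj : j + 1 ≤ A
        · rw [show A - (j + 1) + (s + 1) = A - j + s by omega]
          push_cast
          ring
        · rw [Nat.choose_eq_zero_of_lt (by omega : A < j + 1)]
          push_cast
          ring
      rw [Finset.sum_congr rfl h3, Finset.sum_sub_distrib, h2]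
      rw [Nat.choose_succ_succ] at h1
      rw [show A + 1 - 0 + s = A - 0 + (s + 1) by omega]
      push_cast at h1 ⊢
      simp only [Nat.choose_zero_right] at h1 ⊢
      linarith

/-- The exponents below a given one, each bounded coordinatewise. -/
noncomputable def exponentsLE [DecidableEq V] (b : V →₀ ℕ) : Finset (V →₀ ℕ) :=
  (Fintype.piFinset fun v => Finset.range (b v + 1)).map
    Finsupp.equivFunOnFinite.symm.toEmbedding

theorem le_of_mem_exponentsLE [DecidableEq V] {b j : V →₀ ℕ} (h : j ∈ exponentsLE b) : j ≤ b := by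
  obtain ⟨p, hp, rfl⟩ := Finset.mem_map.1 h
  intro v
  exact Nat.lt_succ_iff.1 (Finset.mem_range.1 (Fintype.mem_piFinset.1 hp v))

/-- The sign of a multi-index. -/
def multisign (j : V →₀ ℕ) : ℤ := ∏ v, (-1) ^ j v

theorem sum_multisign_mul_multichoose [DecidableEq V] (A s b : V →₀ ℕ) :
    ∑ j ∈ exponentsLE b, multisign j * (multichoose A j * multichoose (A - j + s) (b - j) : ℕ) =
      (multichoose s b : ℕ) := by
  rw [exponentsLE, Finset.sum_map]
  have h := Finset.prod_univ_sum (fun v => Finset.range (b v + 1)) (fun v j =>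
    (-1 : ℤ) ^ j * ((A v).choose j * (A v - j + s v).choose (b v - j) : ℕ))
  rw [Finset.prod_congr rfl fun v _ => sum_alternating_choose_mul_choose (A v) (s v) (b v)] at h
  rw [multichoose, Nat.cast_prod, h]
  refine Finset.sum_congr rfl fun p _ => ?_
  rw [Finset.prod_mul_distrib, multichoose, multichoose, ← Finset.prod_mul_distrib, Nat.cast_prod]
  rfl

end Binomials

/-! ### The operators `x ^ c ∂ ^ (e)` -/

section Op

open MvPolynomial

variable {k : Type*} [CommRing k] {V : Type*} [Fintype V] [DecidableEq V]
  {K : PreAbstractSimplicialComplex V}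

open Classical in
/-- The operator `x ^ c ∂ ^ (e)` with divided powers of derivatives, if it preserves the face
ideal. -/
noncomputable def op (c e : V →₀ ℕ) : Module.End k (FaceRing k K) :=
  if h : StarLE K c.support e.support then
    descend ((basisMonomials V k).constr k fun a => (multichoose a e : k) • mon k K (a - e + c))
      (faceIdeal_le_ker fun a ha => by
        have h1 : monomial a (1 : k) = basisMonomials V k a := by rw [coe_basisMonomials]
        rw [h1, Module.Basis.constr_basis]
        by_cases he : e ≤ a
        · rw [mon_eq_zero, smul_zero]
          rw [support_add_eq_union]
          -- If (a - e) ∪ supp c were a face, the star condition would make (a - e) ∪ supp e = supp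
          -- a one too.
          intro hf
          have := h _ hf
          rw [← support_add_eq_union, tsub_add_cancel_of_le he] at this
          exact ha this
        · rw [multichoose_eq_zero he, Nat.cast_zero, zero_smul])
  else 0

theorem op_mon {c e : V →₀ ℕ} (h : StarLE K c.support e.support) (a : V →₀ ℕ) :
    op c e (mon k K a) = (multichoose a e : k) • mon k K (a - e + c) := by
  rw [op, dif_pos h, mon, descend_mk]
  have h1 : monomial a (1 : k) = basisMonomials V k a := by rw [coe_basisMonomials]
  rw [h1, Module.Basis.constr_basis]

theorem op_mon_of_not_le {c e a : V →₀ ℕ} (h : ¬ e ≤ a) : op c e (mon k K a) = 0 := by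
  by_cases hc : StarLE K c.support e.support
  · rw [op_mon hc, multichoose_eq_zero h, Nat.cast_zero, zero_smul]
  · rw [op, dif_neg hc, LinearMap.zero_apply]

theorem op_mon_self {c e : V →₀ ℕ} (h : StarLE K c.support e.support) :
    op c e (mon k K e) = mon k K c := by
  rw [op_mon h, multichoose_self, Nat.cast_one, one_smul, tsub_self, zero_add]

theorem op_zero (c : V →₀ ℕ) : op c 0 = Algebra.lmul k (FaceRing k K) (mon k K c) := by
  refine end_ext fun a _ => ?_
  rw [op_mon (starLE_zero c), multichoose_zero, Nat.cast_one, one_smul, tsub_zero, add_comm,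
    mon_add]
  rfl

/-- By Pascal's rule the commutator of x^c ∂^(e) with x_v is x^c ∂^(e - v), or 0 when e does not
involve v; commutators with variables suffice. -/
theorem op_mem_diffOpsOfOrder (c : V →₀ ℕ) (n : ℕ) : ∀ e : V →₀ ℕ, e.degree ≤ n →
    op c e ∈ diffOpsOfOrder k (FaceRing k K) n := by
  induction n with
  | zero =>
    intro e he
    obtain rfl : e = 0 := (Finsupp.degree_eq_zero_iff e).1 (Nat.le_zero.1 he)
    rw [op_zero]
    exact ⟨_, rfl⟩
  | succ n ih =>
    intro e he
    by_cases hc : StarLE K c.support e.support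
    swap
    · rw [op, dif_neg hc]
      exact zero_mem _
    refine mem_diffOpsOfOrder_succ_of_adjoin adjoin_mon_single ?_
    rintro _ ⟨v, rfl⟩
    by_cases hv : e v = 0
    · convert zero_mem (diffOpsOfOrder k (FaceRing k K) n)
      refine end_ext fun a _ => ?_
      change op c e (mon k K (Finsupp.single v 1) * mon k K a) -
        mon k K (Finsupp.single v 1) * op c e (mon k K a) = 0
      rw [← mon_add, op_mon hc, op_mon hc, multichoose_single_add_of_eq_zero hv, mul_smul_comm,
        ← mon_add]
      by_cases hea : e ≤ a
      · rw [add_tsub_assoc_of_le hea, add_assoc, sub_self]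
      · rw [multichoose_eq_zero hea, Nat.cast_zero, zero_smul, zero_smul, sub_zero]
    · obtain ⟨e, rfl⟩ : ∃ e', e = Finsupp.single v 1 + e' :=
        exists_add_of_le (Finsupp.single_le_iff.2 (Nat.one_le_iff_ne_zero.2 hv))
      rw [map_add, Finsupp.degree_single] at he
      have hc' : StarLE K c.support e.support :=
        hc.trans (StarLE.of_subset (by rw [support_add_eq_union]; exact Finset.subset_union_right))
      convert ih e (by omega)
      refine end_ext fun a _ => ?_
      change op c _ (mon k K (Finsupp.single v 1) * mon k K a) -
        mon k K (Finsupp.single v 1) * op c _ (mon k K a) = _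
      rw [← mon_add, op_mon hc, op_mon hc, op_mon hc', multichoose_single_add_single_add,
        mul_smul_comm, ← mon_add, Nat.cast_add, add_smul, add_tsub_add_eq_tsub_left,
        add_sub_assoc, add_eq_left, sub_eq_zero]
      by_cases hea : Finsupp.single v 1 + e ≤ a
      · rw [← add_assoc, ← tsub_tsub, ]
        congr 3
        rw [tsub_tsub, ← add_tsub_assoc_of_le hea, add_tsub_add_eq_tsub_left]
      · rw [multichoose_eq_zero hea, Nat.cast_zero, zero_smul, zero_smul]

theorem op_mem_diffOps (c e : V →₀ ℕ) : op c e ∈ DiffOps k (FaceRing k K) :=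
  ⟨e.degree, op_mem_diffOpsOfOrder c _ e le_rfl⟩

/-- Sandwiching a monomial `x ^ m` between operators `x ^ c ∂ ^ (j)`. -/
theorem sum_op_mul_mon_mul_op {c e m b : V →₀ ℕ} (hce : StarLE K c.support e.support)
    (hcb : StarLE K c.support b.support) :
    ∑ j ∈ exponentsLE b, (multisign j * (multichoose (e + j) e : ℕ)) •
      (op c (b - j) * Algebra.lmul k (FaceRing k K) (mon k K m) * op c (e + j)) =
    (multichoose (c + m) b : k) • (Algebra.lmul k (FaceRing k K) (mon k K (c + m - b)) * op c e) := by
  refine end_ext fun a _ => ?_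
  have hsub : ∀ j ∈ exponentsLE b, StarLE K c.support (b - j).support ∧
      StarLE K c.support (e + j).support := by
    intro j hj
    have hj' := le_of_mem_exponentsLE hj
    constructor
    · refine hcb.trans (StarLE.of_subset fun v hv => ?_)
      simp only [Finsupp.mem_support_iff, Finsupp.coe_tsub, Pi.sub_apply] at *
      omega
    · rw [support_add_eq_union]
      refine hce.union (hcb.trans (StarLE.of_subset fun v hv => ?_))
      have := hj' v
      simp only [Finsupp.mem_support_iff] at *
      omega
  rw [LinearMap.sum_apply]
  change _ = (multichoose (c + m) b : k) • (mon k K (c + m - b) * op c e (mon k K a))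
  by_cases hea : e ≤ a
  swap
  · rw [op_mon_of_not_le hea, mul_zero, smul_zero]
    refine Finset.sum_eq_zero fun j _ => ?_
    change (multisign j * (multichoose (e + j) e : ℕ)) •
      op c (b - j) (mon k K m * op c (e + j) (mon k K a)) = 0
    rw [op_mon_of_not_le (fun h => hea (le_trans le_self_add h)), mul_zero, map_zero, smul_zero]
  obtain ⟨A, rfl⟩ := exists_add_of_le hea
  have hterm : ∀ j ∈ exponentsLE b, ((multisign j * (multichoose (e + j) e : ℕ)) •
      (op c (b - j) * Algebra.lmul k (FaceRing k K) (mon k K m) * op c (e + j)) :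
        Module.End k (FaceRing k K)) (mon k K (e + A)) =
      ((multisign j * (multichoose A j * multichoose (A - j + (c + m)) (b - j) : ℕ) : ℤ) : k) •
        (multichoose (e + A) e : k) • mon k K (A + (c + m) - b + c) := by
    intro j hj
    obtain ⟨h1, h2⟩ := hsub j hj
    change (multisign j * (multichoose (e + j) e : ℕ)) •
      op c (b - j) (mon k K m * op c (e + j) (mon k K (e + A))) = _
    have h3 : m + (e + A - (e + j) + c) = A - j + (c + m) := by
      rw [add_tsub_add_eq_tsub_left, add_comm, add_assoc]
    rw [op_mon h2, mul_smul_comm, ← mon_add, map_smul, op_mon h1, h3,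
      ← Int.cast_smul_eq_zsmul k, smul_smul, smul_smul, smul_smul]
    have h4 := multichoose_mul e A j
    by_cases hjA : j ≤ A
    · have h5 : A - j + (c + m) - (b - j) = A + (c + m) - b := by
        have h6 := le_of_mem_exponentsLE hj
        ext v
        have h7 := hjA v
        have h8 := h6 v
        simp only [Finsupp.coe_tsub, Pi.sub_apply, Finsupp.add_apply]
        omega
      rw [h5]
      congr 1
      have h4' := congrArg (Nat.cast : ℕ → k) h4
      push_cast at h4' ⊢
      linear_combination ((multisign j : ℤ) : k) *
        (multichoose (A - j + (c + m)) (b - j) : k) * h4'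
    · have h9 : ¬ e + j ≤ e + A := fun h => hjA (le_of_add_le_add_left h)
      rw [multichoose_eq_zero h9, multichoose_eq_zero hjA]
      simp
  rw [Finset.sum_congr rfl hterm, ← Finset.sum_smul, ← Int.cast_sum,
    sum_multisign_mul_multichoose, op_mon hce, add_tsub_cancel_left, mul_smul_comm, ← mon_add,
    Int.cast_natCast]
  by_cases hb : b ≤ c + m
  · rw [add_tsub_assoc_of_le hb, ← add_assoc, add_comm A]
  · rw [multichoose_eq_zero hb, Nat.cast_zero, zero_smul, zero_smul]

end Op


/-! ### Monomial ideals and the expansion of differential operators -/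

section Expansion

variable {k : Type*} [CommRing k] {V : Type*} {K : PreAbstractSimplicialComplex V}

variable (k K) in
/-- The ideal of the face ring spanned by the monomials with exponent in an upper set. -/
noncomputable def monomialIdeal (S : UpperSet (V →₀ ℕ)) : Ideal (FaceRing k K) where
  carrier := {r | ∀ c, coef c r ≠ 0 → c ∈ S}
  zero_mem' := fun c h => absurd (map_zero _) h
  add_mem' := by
    intro r s hr hs c h
    by_cases h1 : coef c r = 0
    · refine hs c fun h2 => h ?_
      rw [map_add, h1, h2, add_zero]
    · exact hr c h1
  smul_mem' := by
    intro s r hr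
    induction s using mon_induction with
    | mon a =>
      intro c h
      obtain ⟨b, rfl, hb⟩ := coef_mon_mul_ne_zero h
      exact S.upper le_add_self (hr b hb)
    | add s t hs ht =>
      intro c h
      rw [add_smul] at h
      by_cases h1 : coef c (s • r) = 0
      · refine ht c fun h2 => h ?_
        rw [map_add, h1, h2, add_zero]
      · exact hs c h1
    | smul a s hs =>
      intro c h
      refine hs c fun h2 => h ?_
      rw [smul_assoc, map_smul, h2, smul_zero]

theorem mon_mem_monomialIdeal {S : UpperSet (V →₀ ℕ)} {a : V →₀ ℕ} (h : a ∈ S) :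
    mon k K a ∈ monomialIdeal k K S := by
  intro c hc
  by_cases h1 : a = c
  · rwa [← h1]
  · exact absurd (coef_mon_ne h1) hc

theorem smul_mem_monomialIdeal {S : UpperSet (V →₀ ℕ)} {r : FaceRing k K} (c : k)
    (h : r ∈ monomialIdeal k K S) : c • r ∈ monomialIdeal k K S := by
  rw [Algebra.smul_def]
  exact Ideal.mul_mem_left _ _ h

theorem apply_mem_monomialIdeal {S : UpperSet (V →₀ ℕ)} {φ : Module.End k (FaceRing k K)}
    (h : ∀ a, φ (mon k K a) ∈ monomialIdeal k K S) (r : FaceRing k K) :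
    φ r ∈ monomialIdeal k K S := by
  induction r using mon_induction with
  | mon a => exact h a
  | add r s hr hs => rw [map_add]; exact add_mem hr hs
  | smul c r hr => rw [map_smul]; exact smul_mem_monomialIdeal c hr

variable [Fintype V] [DecidableEq V]

/-- The operators `x ^ c ∂ ^ (e)` with `c` in a given upper set. -/
def opsOver (k : Type*) [CommRing k] (K : PreAbstractSimplicialComplex V)
    (S : UpperSet (V →₀ ℕ)) : Set (Module.End k (FaceRing k K)) :=
  {ψ | ∃ c e : V →₀ ℕ, c ∈ S ∧ IsFace K c.support ∧ StarLE K c.support e.support ∧ ψ = op c e}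

theorem apply_mem_of_mem_span_opsOver {S : UpperSet (V →₀ ℕ)} {φ : Module.End k (FaceRing k K)}
    (h : φ ∈ Submodule.span k (opsOver k K S)) (r : FaceRing k K) :
    φ r ∈ monomialIdeal k K S := by
  induction h using Submodule.span_induction with
  | mem φ h =>
    obtain ⟨c, e, hc, -, hce, rfl⟩ := h
    refine apply_mem_monomialIdeal (fun a => ?_) r
    rw [op_mon hce]
    exact smul_mem_monomialIdeal _ (mon_mem_monomialIdeal (S.upper le_add_self hc))
  | zero => rw [LinearMap.zero_apply]; exact zero_mem _
  | add φ ψ _ _ h1 h2 => rw [LinearMap.add_apply]; exact add_mem h1 h2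
  | smul c φ _ h => rw [LinearMap.smul_apply]; exact smul_mem_monomialIdeal c h

/-- A differential operator can be matched at one monomial of degree `N` without changing the
values at other monomials of degree at most `N`. -/
theorem exists_mem_span_opsOver_apply_eq {S : UpperSet (V →₀ ℕ)}
    {φ : Module.End k (FaceRing k K)} (hφ : φ ∈ DiffOps k (FaceRing k K))
    (hS : ∀ r, φ r ∈ monomialIdeal k K S) (e : V →₀ ℕ) :
    ∃ ψ ∈ Submodule.span k (opsOver k K S), ψ ∈ diffOpsOfOrder k (FaceRing k K) e.degree ∧
      ψ (mon k K e) = φ (mon k K e) ∧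
      ∀ a : V →₀ ℕ, a.degree ≤ e.degree → a ≠ e → ψ (mon k K a) = 0 := by
  obtain ⟨s, -, hs⟩ := exists_eq_sum_mon (φ (mon k K e))
  refine ⟨∑ c ∈ s, coef c (φ (mon k K e)) • op c e, ?_, ?_, ?_, ?_⟩
  · refine Submodule.sum_mem _ fun c _ => ?_
    by_cases h : coef c (φ (mon k K e)) = 0
    · rw [h, zero_smul]
      exact zero_mem _
    · exact Submodule.smul_mem _ _ (Submodule.subset_span ⟨c, e, hS _ c h,
        isFace_of_coef_ne_zero h, starLE_of_coef_ne_zero hφ h, rfl⟩)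
  · exact Submodule.sum_mem _ fun c _ => Submodule.smul_mem _ _ (op_mem_diffOpsOfOrder c _ e le_rfl)
  · rw [LinearMap.sum_apply]
    conv_rhs => rw [hs]
    refine Finset.sum_congr rfl fun c _ => ?_
    rw [LinearMap.smul_apply]
    by_cases h : coef c (φ (mon k K e)) = 0
    · rw [h, zero_smul, zero_smul]
    · rw [op_mon_self (starLE_of_coef_ne_zero hφ h)]
  · intro a ha hae
    rw [LinearMap.sum_apply]
    refine Finset.sum_eq_zero fun c _ => ?_
    rw [LinearMap.smul_apply, op_mon_of_not_le, smul_zero]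
    intro hle
    obtain ⟨d, rfl⟩ := exists_add_of_le hle
    rw [map_add] at ha
    exact hae (by rw [(Finsupp.degree_eq_zero_iff d).1 (by omega), add_zero])

/-- Every differential operator with values in a monomial ideal is a combination of operators
`x ^ c ∂ ^ (e)` with `x ^ c` in that ideal. -/
theorem mem_span_opsOver {S : UpperSet (V →₀ ℕ)} {φ : Module.End k (FaceRing k K)}
    (hφ : φ ∈ DiffOps k (FaceRing k K)) (hS : ∀ r, φ r ∈ monomialIdeal k K S) :
    φ ∈ Submodule.span k (opsOver k K S) := by
  obtain ⟨n, hn⟩ := hφ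
  -- Values are cleared degree by degree: φ vanishes on monomials of degree below N, and m counts
  -- the degrees up to n still to be treated.
  suffices H : ∀ m N : ℕ, N + m = n + 1 → ∀ φ ∈ diffOpsOfOrder k (FaceRing k K) n,
      (∀ r, φ r ∈ monomialIdeal k K S) → (∀ a : V →₀ ℕ, a.degree < N → φ (mon k K a) = 0) →
      φ ∈ Submodule.span k (opsOver k K S) from
    H (n + 1) 0 (zero_add _) φ hn hS fun a ha => absurd ha (Nat.not_lt_zero _)
  intro m
  induction m with
  | zero =>
    intro N hN φ hφ _ h0
    rw [eq_zero_of_mon_degree_le n φ hφ fun a ha => h0 a (by omega)]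
    exact zero_mem _
  | succ m ih =>
    intro N hN φ hφ hS h0
    choose ψ hψ1 hψ2 hψ3 hψ4 using exists_mem_span_opsOver_apply_eq (S := S) ⟨n, hφ⟩ hS
    have hT : ∀ e : V →₀ ℕ, e ∈ Finset.finsuppAntidiag Finset.univ N ↔ e.degree = N := by
      intro e
      rw [Finset.mem_finsuppAntidiag, Finsupp.degree_eq_sum]
      simp
    have hsum : ∑ e ∈ Finset.finsuppAntidiag Finset.univ N, ψ e ∈
        Submodule.span k (opsOver k K S) := Submodule.sum_mem _ fun e _ => hψ1 e
    rw [← sub_add_cancel φ (∑ e ∈ Finset.finsuppAntidiag Finset.univ N, ψ e)]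
    refine add_mem (ih (N + 1) (by omega) _ ?_ ?_ ?_) hsum
    · refine sub_mem hφ (Submodule.sum_mem _ fun e he => ?_)
      exact diffOpsOfOrder_mono (by rw [(hT e).1 he]; omega) (hψ2 e)
    · intro r
      rw [LinearMap.sub_apply]
      exact sub_mem (hS r) (apply_mem_of_mem_span_opsOver hsum r)
    · intro a ha
      rw [LinearMap.sub_apply, LinearMap.sum_apply]
      by_cases haN : a.degree = N
      · rw [Finset.sum_eq_single a, hψ3, sub_self]
        · intro e he hea
          exact hψ4 e a (by rw [(hT e).1 he, haN]) hea.symm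
        · intro h
          exact absurd ((hT a).2 haN) h
      · rw [h0 a (by omega), Finset.sum_eq_zero, sub_zero]
        intro e he
        have := (hT e).1 he
        exact hψ4 e a (by omega) (by rintro rfl; exact haN this)

end Expansion

/-! ### The annihilators of the strata -/

section Strata

variable {k : Type*} [CommRing k] {V : Type*} [DecidableEq V]

/-- The exponents `c` such that the closed star of `σ` is not contained in that of the support
of `c`. -/
def stratum (K : PreAbstractSimplicialComplex V) (σ : Finset V) : UpperSet (V →₀ ℕ) where
  carrier := {c | ¬ StarLE K σ c.support}
  upper' := by
    intro a b hab ha hb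
    refine ha (hb.trans (StarLE.of_subset fun v hv => ?_))
    have := hab v
    simp only [Finsupp.mem_support_iff] at *
    omega

variable {K : PreAbstractSimplicialComplex V}

theorem mem_stratum {σ : Finset V} {c : V →₀ ℕ} : c ∈ stratum K σ ↔ ¬ StarLE K σ c.support :=
  Iff.rfl

/-- If x^c occurs in φ(x^b), then st(σ) ⊆ st(supp c) would give st(σ) ⊆ st(supp b). This makes
`stratumAnn` a left ideal. -/
theorem diffOps_apply_mem_stratum {σ : Finset V} {φ : Module.End k (FaceRing k K)}
    (hφ : φ ∈ DiffOps k (FaceRing k K)) {r : FaceRing k K}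
    (hr : r ∈ monomialIdeal k K (stratum K σ)) : φ r ∈ monomialIdeal k K (stratum K σ) := by
  obtain ⟨s, -, hs⟩ := exists_eq_sum_mon r
  rw [hs, map_sum]
  refine Submodule.sum_mem _ fun b _ => ?_
  rw [map_smul]
  by_cases hb : coef b r = 0
  · rw [hb, zero_smul]
    exact zero_mem _
  · refine smul_mem_monomialIdeal _ fun c hc hσ => ?_
    exact hr b hb (hσ.trans (starLE_of_coef_ne_zero hφ hc))

variable (k K) in
/-- The differential operators that vanish on the quotient of the face ring by the monomials in
`stratum K σ`. -/
noncomputable def stratumAnn (σ : Finset V) : TwoSidedIdeal (DiffOps k (FaceRing k K)) :=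
  TwoSidedIdeal.mk' {φ | ∀ r, φ.1 r ∈ monomialIdeal k K (stratum K σ)}
    (fun _ => zero_mem _)
    (fun hφ hψ r => add_mem (hφ r) (hψ r))
    (fun hφ r => neg_mem (hφ r))
    (fun {φ _} hψ r => diffOps_apply_mem_stratum φ.2 (hψ r))
    (fun {_ ψ} hφ r => hφ (ψ.1 r))

theorem mem_stratumAnn {σ : Finset V} {φ : DiffOps k (FaceRing k K)} :
    φ ∈ stratumAnn k K σ ↔ ∀ r, φ.1 r ∈ monomialIdeal k K (stratum K σ) :=
  TwoSidedIdeal.mem_mk' _ _ _ _ _ _ _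

theorem stratumAnn_mono {σ τ : Finset V} (h : StarLE K σ τ) :
    stratumAnn k K σ ≤ stratumAnn k K τ := by
  intro φ hφ
  rw [mem_stratumAnn] at *
  exact fun r c hc hτ => hφ r c hc (h.trans hτ)

theorem toDiffOps_mem_stratumAnn {σ : Finset V} {r : FaceRing k K} :
    toDiffOps k (FaceRing k K) r ∈ stratumAnn k K σ ↔ r ∈ monomialIdeal k K (stratum K σ) := by
  rw [mem_stratumAnn]
  constructor
  · intro h
    have := h 1
    change r * 1 ∈ _ at this
    rwa [mul_one] at this
  · intro h s
    exact Ideal.mul_mem_right s _ h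

/-- The exponent of the square-free monomial on `σ`. -/
noncomputable def indicator (σ : Finset V) : V →₀ ℕ := ∑ v ∈ σ, Finsupp.single v 1

theorem indicator_apply (σ : Finset V) (w : V) : indicator σ w = if w ∈ σ then 1 else 0 := by
  rw [indicator, Finsupp.finsetSum_apply]
  simp [Finsupp.single_apply]

theorem support_indicator (σ : Finset V) : (indicator σ).support = σ := by
  ext w
  rw [Finsupp.mem_support_iff, indicator_apply]
  simp

theorem mon_indicator_notMem [Nontrivial k] {σ : Finset V} (hσ : IsFace K σ) :
    mon k K (indicator σ) ∉ monomialIdeal k K (stratum K σ) := by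
  intro h
  refine h (indicator σ) ?_ ?_
  · rw [coef_mon_self (by rwa [support_indicator])]
    exact one_ne_zero
  · rw [support_indicator]
    exact StarLE.refl σ

theorem stratumAnn_ne_top [Nontrivial k] {σ : Finset V} (hσ : IsFace K σ) :
    stratumAnn k K σ ≠ ⊤ := by
  intro h
  have h1 : toDiffOps k (FaceRing k K) (mon k K (indicator σ)) ∈ stratumAnn k K σ := by
    rw [h]
    trivial
  exact mon_indicator_notMem hσ (toDiffOps_mem_stratumAnn.1 h1)

/-- Discarding the monomials in the stratum leaves a representative whose terms meet the star
condition of `exists_coef_smul_diffOp_mem`. -/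
theorem exists_sub_mem_stratum (σ : Finset V) (r : FaceRing k K) :
    ∃ r' : FaceRing k K, r - r' ∈ monomialIdeal k K (stratum K σ) ∧
      ∀ b, coef b r' ≠ 0 → StarLE K σ b.support := by
  induction r using mon_induction with
  | mon a =>
    by_cases h : StarLE K σ a.support
    · refine ⟨mon k K a, by rw [sub_self]; exact zero_mem _, fun b hb => ?_⟩
      by_cases hab : a = b
      · rwa [← hab]
      · exact absurd (coef_mon_ne hab) hb
    · refine ⟨0, ?_, fun b hb => absurd (map_zero _) hb⟩
      rw [sub_zero]
      exact mon_mem_monomialIdeal h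
  | add r s hr hs =>
    obtain ⟨r', h1, h2⟩ := hr
    obtain ⟨s', h3, h4⟩ := hs
    refine ⟨r' + s', by rw [add_sub_add_comm]; exact add_mem h1 h3, fun b hb => ?_⟩
    by_cases h5 : coef b r' = 0
    · refine h4 b fun h6 => hb ?_
      rw [map_add, h5, h6, add_zero]
    · exact h2 b h5
  | smul c r hr =>
    obtain ⟨r', h1, h2⟩ := hr
    refine ⟨c • r', by rw [← smul_sub]; exact smul_mem_monomialIdeal c h1, fun b hb => ?_⟩
    refine h2 b fun h => hb ?_
    rw [map_smul, h, smul_zero]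

end Strata

/-! ### Two-sided ideals -/

section TwoSidedGeneral

variable {k : Type*} [CommRing k]

/-- If a two-sided ideal is not contained in `J`, it contains an operator outside `J` that commutes
with `R` modulo `J`. -/
theorem exists_mem_commutator_mem {R : Type*} [CommRing R] [Algebra k R]
    {I J : TwoSidedIdeal (DiffOps k R)} (n : ℕ) :
    ∀ φ : DiffOps k R, φ.1 ∈ diffOpsOfOrder k R n → φ ∈ I → φ ∉ J →
    ∃ ψ ∈ I, ψ ∉ J ∧ ∀ r, ψ * toDiffOps k R r - toDiffOps k R r * ψ ∈ J := by
  induction n with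
  | zero =>
    rintro φ ⟨s, hs⟩ hφ hφJ
    refine ⟨φ, hφ, hφJ, fun r => ?_⟩
    have : φ = toDiffOps k R s := Subtype.ext hs.symm
    have h : φ * toDiffOps k R r = toDiffOps k R r * φ := by
      rw [this, ← map_mul, ← map_mul, mul_comm]
    rw [show φ * toDiffOps k R r - toDiffOps k R r * φ = 0 from sub_eq_zero.2 h]
    exact J.zero_mem
  | succ n ih =>
    intro φ hn hφ hφJ
    by_cases h : ∀ r, φ * toDiffOps k R r - toDiffOps k R r * φ ∈ J
    · exact ⟨φ, hφ, hφJ, h⟩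
    -- A commutator outside J still lies in I and has smaller order, so it can replace φ.
    · obtain ⟨r, hr⟩ := not_forall.1 h
      exact ih _ (hn r) (I.sub_mem (I.mul_mem_right _ _ hφ) (I.mul_mem_left _ _ hφ)) hr

theorem mem_of_sub_mem_twoSidedIdeal {A : Type*} [Ring A] {I : TwoSidedIdeal A} {x y : A}
    (hx : x ∈ I) (h : x - y ∈ I) : y ∈ I := by
  rw [← sub_sub_cancel x y]
  exact I.sub_mem hx h

theorem smul_mem_twoSidedIdeal {A : Type*} [Ring A] [Algebra k A] {I : TwoSidedIdeal A} (c : k)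
    {x : A} (h : x ∈ I) : c • x ∈ I := by
  rw [Algebra.smul_def]
  exact I.mul_mem_left _ _ h

/-- The underlying `k`-module of a two-sided ideal. -/
def twoSidedSubmodule {A : Type*} [Ring A] [Algebra k A] (I : TwoSidedIdeal A) :
    Submodule k A where
  carrier := {x | x ∈ I}
  zero_mem' := I.zero_mem
  add_mem' := I.add_mem
  smul_mem' c _ h := smul_mem_twoSidedIdeal c h

end TwoSidedGeneral

/-! ### Producing the operators supported on a stratum inside a two-sided ideal -/

section TwoSided

variable {k : Type*} [CommRing k] {V : Type*} [Fintype V] [DecidableEq V]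
  {K : PreAbstractSimplicialComplex V}

/-- The operator `x ^ c ∂ ^ (e)` as an element of the ring of differential operators. -/
noncomputable def diffOp (c e : V →₀ ℕ) : DiffOps k (FaceRing k K) := ⟨op c e, op_mem_diffOps c e⟩

theorem diffOp_zero (c : V →₀ ℕ) : diffOp c 0 = toDiffOps k (FaceRing k K) (mon k K c) :=
  Subtype.ext (op_zero c)

theorem mem_twoSidedIdeal_of_apply_mem {I : TwoSidedIdeal (DiffOps k (FaceRing k K))}
    {S : UpperSet (V →₀ ℕ)}
    (hI : ∀ c e : V →₀ ℕ, c ∈ S → IsFace K c.support → StarLE K c.support e.support →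
      diffOp c e ∈ I)
    {φ : DiffOps k (FaceRing k K)} (hφ : ∀ r, φ.1 r ∈ monomialIdeal k K S) : φ ∈ I := by
  have h : Submodule.span k (opsOver k K S) ≤
      (twoSidedSubmodule (k := k) I).map (DiffOps k (FaceRing k K)).val.toLinearMap := by
    rw [Submodule.span_le]
    rintro _ ⟨c, e, hc, hc', hce, rfl⟩
    exact ⟨diffOp c e, hI c e hc hc' hce, rfl⟩
  obtain ⟨ψ, hψ, hψφ⟩ := h (mem_span_opsOver φ.2 hφ)
  rwa [← show ψ = φ from Subtype.ext hψφ]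

/-- A polynomial in a two-sided ideal produces multiples of operators `x ^ c ∂ ^ (e)`. -/
theorem exists_coef_smul_diffOp_mem {I : TwoSidedIdeal (DiffOps k (FaceRing k K))}
    {r : FaceRing k K} (hr : toDiffOps k (FaceRing k K) r ∈ I) (h0 : r ≠ 0) {c e : V →₀ ℕ}
    (hrc : ∀ m, coef m r ≠ 0 → StarLE K c.support m.support)
    (hce : StarLE K c.support e.support) :
    ∃ m, coef m r ≠ 0 ∧ coef m r • diffOp c e ∈ I := by
  classical
  obtain ⟨s, hs, hrs⟩ := exists_eq_sum_mon r
  obtain ⟨m₁, hm₁⟩ : ∃ m, coef m r ≠ 0 := by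
    by_contra! h
    exact h0 (eq_zero_of_coef h)
  -- With b = c + m₀ and m₀ of maximal degree, b ≤ c + m forces m = m₀, so every other term of r
  -- drops out of the sandwich sum.
  obtain ⟨m₀, hm₀, hmax⟩ := (s.filter fun m => coef m r ≠ 0).exists_max_image Finsupp.degree
    ⟨m₁, Finset.mem_filter.2 ⟨hs _ hm₁, hm₁⟩⟩
  rw [Finset.mem_filter] at hm₀
  have hcb : StarLE K c.support (c + m₀).support := by
    rw [support_add_eq_union]
    exact (StarLE.refl _).union (hrc _ hm₀.2)
  refine ⟨m₀, hm₀.2, ?_⟩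
  have hmem : ∑ j ∈ exponentsLE (c + m₀), (multisign j * (multichoose (e + j) e : ℕ)) •
      (diffOp c (c + m₀ - j) * toDiffOps k (FaceRing k K) r * diffOp c (e + j)) ∈ I :=
    sum_mem fun j _ => I.zsmul_mem _ (I.mul_mem_right _ _ (I.mul_mem_left _ _ hr))
  convert hmem using 1
  refine Subtype.ext ?_
  have hlmul : Algebra.lmul k (FaceRing k K) r =
      ∑ m ∈ s, coef m r • Algebra.lmul k (FaceRing k K) (mon k K m) := by
    conv_lhs => rw [hrs, map_sum]
    exact Finset.sum_congr rfl fun m _ => map_smul _ _ _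
  have hval : ((∑ j ∈ exponentsLE (c + m₀), (multisign j * (multichoose (e + j) e : ℕ)) •
      (diffOp c (c + m₀ - j) * toDiffOps k (FaceRing k K) r * diffOp c (e + j)) :
        DiffOps k (FaceRing k K)) : Module.End k (FaceRing k K)) =
      ∑ j ∈ exponentsLE (c + m₀), (multisign j * (multichoose (e + j) e : ℕ)) •
      (op c (c + m₀ - j) * Algebra.lmul k (FaceRing k K) r * op c (e + j)) := by
    rw [AddSubmonoidClass.coe_finsetSum]
    rfl
  rw [hval, hlmul]
  have hdist : ∀ j ∈ exponentsLE (c + m₀), (multisign j * (multichoose (e + j) e : ℕ)) •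
      (op c (c + m₀ - j) * (∑ m ∈ s, coef m r • Algebra.lmul k (FaceRing k K) (mon k K m)) *
        op c (e + j)) = ∑ m ∈ s, coef m r • ((multisign j * (multichoose (e + j) e : ℕ)) •
      (op c (c + m₀ - j) * Algebra.lmul k (FaceRing k K) (mon k K m) * op c (e + j))) := by
    intro j _
    rw [Finset.mul_sum, Finset.sum_mul, Finset.smul_sum]
    refine Finset.sum_congr rfl fun m _ => ?_
    rw [mul_smul_comm, smul_mul_assoc, smul_comm]
  rw [Finset.sum_congr rfl hdist, Finset.sum_comm]
  rw [Finset.sum_eq_single_of_mem m₀ hm₀.1]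
  · rw [← Finset.smul_sum, sum_op_mul_mon_mul_op hce hcb, multichoose_self, Nat.cast_one, one_smul,
      tsub_self, mon_zero, map_one, one_mul]
    rfl
  · intro m hm hne
    rw [← Finset.smul_sum, sum_op_mul_mon_mul_op hce hcb]
    by_cases hcm : coef m r = 0
    · rw [hcm, zero_smul]
    · rw [multichoose_eq_zero, Nat.cast_zero, zero_smul, smul_zero]
      intro hle
      obtain ⟨d, rfl⟩ := exists_add_of_le (le_of_add_le_add_left hle)
      have := hmax _ (Finset.mem_filter.2 ⟨hm, hcm⟩)
      rw [map_add] at this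
      exact hne (by rw [(Finsupp.degree_eq_zero_iff d).1 (by omega), add_zero])

/-- A two-sided ideal with torsion-free quotient that does not annihilate the stratum of `σ`
contains all operators supported there. -/
theorem diffOp_mem_of_not_le [Nontrivial k] {I : TwoSidedIdeal (DiffOps k (FaceRing k K))}
    (hI : ∀ (c : k) (φ : DiffOps k (FaceRing k K)), c ≠ 0 → c • φ ∈ I → φ ∈ I) (σ : Finset V) :
    IsFace K σ → ¬ I ≤ stratumAnn k K σ → ∀ c e : V →₀ ℕ, StarLE K c.support σ →
      StarLE K c.support e.support → diffOp c e ∈ I := by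
  -- The induction runs from larger faces to smaller ones.
  induction σ using WellFoundedGT.induction with
  | ind σ ih =>
  intro hσ hIσ c e hcσ hce
  obtain ⟨φ₀, hφ₀, hφ₀σ⟩ : ∃ φ ∈ I, φ ∉ stratumAnn k K σ := by
    by_contra! h
    exact hIσ h
  obtain ⟨n, hn⟩ := φ₀.2
  obtain ⟨φ, hφ, hφσ, hcomm⟩ := exists_mem_commutator_mem n φ₀ hn hφ₀ hφ₀σ
  have hmul : ∀ r, φ.1 r - r * φ.1 1 ∈ monomialIdeal k K (stratum K σ) := by
    have h1 := apply_mon_sub_mem (φ := φ.1) (monomialIdeal k K (stratum K σ)) fun v r =>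
      mem_stratumAnn.1 (hcomm (mon k K (Finsupp.single v 1))) r
    intro r
    have h2 := apply_mem_monomialIdeal (φ := φ.1 - Algebra.lmul k _ (φ.1 1))
      (S := stratum K σ) (fun a => by
        change φ.1 (mon k K a) - φ.1 1 * mon k K a ∈ _
        rw [mul_comm]
        exact h1 a) r
    change φ.1 r - φ.1 1 * r ∈ _ at h2
    rwa [mul_comm] at h2
  obtain ⟨r₁, hr₁, hr₁σ⟩ := exists_sub_mem_stratum σ (φ.1 1)
  have hr₁' : ∀ r, φ.1 r - r * r₁ ∈ monomialIdeal k K (stratum K σ) := by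
    intro r
    have := add_mem (hmul r) (Ideal.mul_mem_left _ r hr₁)
    rwa [mul_sub, sub_add_sub_cancel] at this
  obtain ⟨b, hb⟩ : ∃ b, coef b r₁ ≠ 0 := by
    by_contra! h
    refine hφσ (mem_stratumAnn.2 fun r => ?_)
    have := hr₁' r
    rwa [eq_zero_of_coef h, mul_zero, sub_zero] at this
  set d := indicator σ
  have hd : d.support = σ := support_indicator σ
  have hdiff : toDiffOps k _ (mon k K d) * φ - toDiffOps k _ (mon k K d * r₁) ∈ I := by
    -- Upper sets are ordered by reverse inclusion, so this join is an intersection: exponents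
    -- divisible by x^σ that also lie in the stratum. Their supports strictly contain σ.
    refine mem_twoSidedIdeal_of_apply_mem (S := UpperSet.Ici d ⊔ stratum K σ) ?_ ?_
    · intro c' e' hc' hc'K hce'
      rw [UpperSet.mem_sup_iff, UpperSet.mem_Ici_iff, mem_stratum] at hc'
      have hsub : σ ⊆ c'.support := by
        intro v hv
        have := hc'.1 v
        rw [← hd] at hv
        rw [Finsupp.mem_support_iff] at *
        omega
      refine ih c'.support (hsub.lt_of_ne ?_) hc'K ?_ c' e' (StarLE.refl _) hce'
      · intro h
        rw [← h] at hc'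
        exact hc'.2 (StarLE.refl _)
      · exact fun h => hIσ (h.trans (stratumAnn_mono (StarLE.of_subset hsub)))
    · intro r
      change mon k K d * φ.1 r - mon k K d * r₁ * r ∈ _
      rw [mul_assoc, ← mul_sub, mul_comm r₁]
      intro c' hc'
      obtain ⟨a, rfl, ha⟩ := coef_mon_mul_ne_zero hc'
      rw [UpperSet.mem_sup_iff, UpperSet.mem_Ici_iff]
      exact ⟨le_self_add, (stratum K σ).upper le_add_self (hr₁' r a ha)⟩
  have hdr : toDiffOps k _ (mon k K d * r₁) ∈ I :=
    mem_of_sub_mem_twoSidedIdeal (I.mul_mem_left (toDiffOps k _ (mon k K d)) φ hφ) hdiff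
  obtain ⟨m, hm, hmI⟩ := exists_coef_smul_diffOp_mem hdr (c := c) (e := e) (fun h => hb (by
      rw [← coef_mon_mul (d := d), h, map_zero]
      rw [support_add_eq_union, hd]
      exact (hr₁σ b hb).isFace hσ)) (fun m hm => by
      obtain ⟨a, rfl, ha⟩ := coef_mon_mul_ne_zero hm
      rw [support_add_eq_union, hd]
      exact hcσ.union (hcσ.trans (hr₁σ a ha))) hce
  exact hI _ _ hm hmI

end TwoSided


/-! ### The lattice of two-sided ideals -/

section StarIdeals

variable {k : Type*} [CommRing k] {V : Type*} [DecidableEq V] {K : PreAbstractSimplicialComplex V}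

theorem smul_mem_stratumAnn_iff [IsDomain k] {c : k} (hc : c ≠ 0) {σ : Finset V}
    {φ : DiffOps k (FaceRing k K)} : c • φ ∈ stratumAnn k K σ ↔ φ ∈ stratumAnn k K σ := by
  refine ⟨fun h => mem_stratumAnn.2 fun r b hb => ?_, smul_mem_twoSidedIdeal c⟩
  refine mem_stratumAnn.1 h r b ?_
  change coef b (c • φ.1 r) ≠ 0
  rw [map_smul]
  exact mul_ne_zero hc hb

theorem starIdeal_le_monomialIdeal {F σ : Finset V} (hF : IsFace K F) (h : IsFace K (F ∪ σ)) :
    starIdeal k K F ≤ monomialIdeal k K (stratum K σ) := by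
  rw [starIdeal, Ideal.map_le_iff_le_comap]
  intro p hp b hb hσ
  have hbK := isFace_of_coef_ne_zero hb
  rw [coef_mk hbK] at hb
  refine (mem_faceIdeal _).1 hp b (MvPolynomial.mem_support_iff.2 hb) ?_
  rw [isFace_closedStar hF, Finset.union_comm]
  exact hσ F h

theorem mon_mem_starIdeal {F : Finset V} (hF : IsFace K F) {a : V →₀ ℕ}
    (h : ¬ IsFace K (F ∪ a.support)) : mon k K a ∈ starIdeal k K F := by
  refine Ideal.mem_map_of_mem _ ((mem_faceIdeal _).2 fun b hb => ?_)
  rw [Finset.mem_singleton.1 (MvPolynomial.support_monomial_subset hb), isFace_closedStar hF,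
    Finset.union_comm]
  exact h

/-- If F ∪ σ is not a face, x^σ lies in the star ideal but not in M_σ. If it is, st(σ) ⊆ st(supp b)
makes F ∪ supp b a face, so x^b is not in the star ideal. -/
theorem extension_le_stratumAnn_iff [Nontrivial k] {F σ : Finset V} (hF : IsFace K F)
    (hσ : IsFace K σ) :
    extension k (starIdeal k K F) ≤ stratumAnn k K σ ↔ IsFace K (F ∪ σ) := by
  rw [extension, TwoSidedIdeal.span_le]
  constructor
  · intro h
    by_contra h1
    refine mon_indicator_notMem (k := k) hσ (toDiffOps_mem_stratumAnn.1 (h ⟨_, ?_, rfl⟩))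
    exact mon_mem_starIdeal hF (by rwa [support_indicator])
  · rintro h _ ⟨r, hr, rfl⟩
    exact toDiffOps_mem_stratumAnn.2 (starIdeal_le_monomialIdeal hF h hr)

end StarIdeals

/-! ### Saturated ideals and the lattice they form -/

section Lattice

variable {k : Type*} [CommRing k] {V : Type*} [Fintype V] [DecidableEq V]
  {K : PreAbstractSimplicialComplex V}

/-- A two-sided ideal is saturated if on each stratum it either vanishes or contains all operators
supported there. -/
def IsSaturated (I : TwoSidedIdeal (DiffOps k (FaceRing k K))) : Prop :=
  ∀ c : V →₀ ℕ, IsFace K c.support → ¬ I ≤ stratumAnn k K c.support →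
    ∀ e : V →₀ ℕ, StarLE K c.support e.support → diffOp c e ∈ I

theorem IsSaturated.mem {I : TwoSidedIdeal (DiffOps k (FaceRing k K))} (hI : IsSaturated I)
    {φ : DiffOps k (FaceRing k K)}
    (h : ∀ σ, IsFace K σ → I ≤ stratumAnn k K σ → φ ∈ stratumAnn k K σ) : φ ∈ I := by
  refine mem_twoSidedIdeal_of_apply_mem
    -- In the reversed order on upper sets this supremum is the intersection of the strata. A face
    -- supp c with I ≤ P_{supp c} is excluded, since c is not in its own stratum.
    (S := ⨆ σ : {σ // IsFace K σ ∧ I ≤ stratumAnn k K σ}, stratum K σ.1) ?_ ?_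
  · intro c e hc hcK hce
    refine hI c hcK (fun hle => ?_) e hce
    exact mem_stratum.1 (UpperSet.mem_iSup_iff.1 hc ⟨c.support, hcK, hle⟩) (StarLE.refl _)
  · intro r c hc
    rw [UpperSet.mem_iSup_iff]
    rintro ⟨σ, hσ, hle⟩
    exact mem_stratumAnn.1 (h σ hσ hle) r c hc

theorem IsSaturated.sup {I J : TwoSidedIdeal (DiffOps k (FaceRing k K))} (hI : IsSaturated I)
    (hJ : IsSaturated J) : IsSaturated (I ⊔ J) := by
  intro c hc h e he
  by_cases h1 : I ≤ stratumAnn k K c.support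
  · by_cases h2 : J ≤ stratumAnn k K c.support
    · exact absurd (sup_le h1 h2) h
    · exact (le_sup_right : J ≤ I ⊔ J) (hJ c hc h2 e he)
  · exact (le_sup_left : I ≤ I ⊔ J) (hI c hc h1 e he)

theorem isSaturated_iff [IsDomain k] {I : TwoSidedIdeal (DiffOps k (FaceRing k K))} :
    IsSaturated I ↔
      ∀ (c : k) (φ : DiffOps k (FaceRing k K)), c ≠ 0 → c • φ ∈ I → φ ∈ I := by
  constructor
  · intro hI c φ hc h
    exact hI.mem fun σ _ hIσ => (smul_mem_stratumAnn_iff hc).1 (hIσ h)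
  · intro hI c hc h e he
    exact diffOp_mem_of_not_le hI c.support hc h c e (StarLE.refl _) he

theorem IsSaturated.inf [IsDomain k] {I J : TwoSidedIdeal (DiffOps k (FaceRing k K))}
    (hI : IsSaturated I) (hJ : IsSaturated J) : IsSaturated (I ⊓ J) := by
  rw [isSaturated_iff] at *
  exact fun c φ hc h => ⟨hI c φ hc h.1, hJ c φ hc h.2⟩

theorem IsSaturated.ne_top_iff [Nontrivial k] {I : TwoSidedIdeal (DiffOps k (FaceRing k K))}
    (hI : IsSaturated I) : I ≠ ⊤ ↔ I ≤ stratumAnn k K ∅ := by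
  constructor
  · intro h
    by_contra h1
    refine h ((TwoSidedIdeal.one_mem_iff I).1 ?_)
    have := hI 0 (by simpa using isFace_empty) (by simpa using h1) 0 (StarLE.refl _)
    rwa [diffOp_zero, mon_zero, map_one] at this
  · rintro h rfl
    exact stratumAnn_ne_top isFace_empty (top_le_iff.1 h)

/-- When F ∪ supp c is not a face, x^c itself is in the ideal; sandwiching this single monomial,
whose coefficient is 1, needs no torsion-freeness. -/
theorem isSaturated_extension_starIdeal [Nontrivial k] {F : Finset V} (hF : IsFace K F) :
    IsSaturated (extension k (starIdeal k K F)) := by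
  intro c hc h e he
  rw [extension_le_stratumAnn_iff hF hc] at h
  have h1 : toDiffOps k _ (mon k K c) ∈ extension k (starIdeal k K F) :=
    TwoSidedIdeal.subset_span ⟨_, mon_mem_starIdeal hF h, rfl⟩
  have hne : mon k K c ≠ 0 := fun h0 => one_ne_zero (α := k) (by
    rw [← coef_mon_self (k := k) hc, h0, map_zero])
  have hm : ∀ m, coef m (mon k K c) ≠ 0 → c = m := fun m hm => by
    by_contra hcm
    exact hm (coef_mon_ne hcm)
  obtain ⟨m, hm1, hm2⟩ := exists_coef_smul_diffOp_mem h1 hne (c := c) (e := e)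
    (fun m h => by rw [hm m h]; exact StarLE.refl _) he
  rwa [← hm m hm1, coef_mon_self hc, one_smul] at hm2

theorem stratumAnn_mem_latticeClosure [Nontrivial k] {σ : Finset V} (hσ : IsFace K σ) :
    stratumAnn k K σ ∈ latticeClosure {I : TwoSidedIdeal (DiffOps k (FaceRing k K)) |
      ∃ σ : Finset V, IsFace K σ ∧ I = extension k (starIdeal k K σ)} := by
  classical
  set T : Finset (Finset V) := Finset.univ.filter fun F => IsFace K F ∧ σ ⊆ F
  have hT : T.Nonempty := ⟨σ, Finset.mem_filter.2 ⟨Finset.mem_univ _, hσ, subset_rfl⟩⟩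
  have hsat : IsSaturated (T.sup' hT fun F => extension k (starIdeal k K F)) :=
    Finset.sup'_induction hT _ (fun I hI J hJ => hI.sup hJ) fun F hF =>
      isSaturated_extension_starIdeal (Finset.mem_filter.1 hF).2.1
  have heq : stratumAnn k K σ = T.sup' hT fun F => extension k (starIdeal k K F) := by
    apply le_antisymm
    · intro φ hφ
      -- The summand F = ρ ∪ σ shows that F ∪ τ, hence ρ ∪ τ, is a face. Thus every P_τ containing
      -- the sum contains P_σ.
      refine hsat.mem fun τ hτ hle => stratumAnn_mono (fun ρ hρ => ?_) hφ
      have hF : ρ ∪ σ ∈ T :=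
        Finset.mem_filter.2 ⟨Finset.mem_univ _, hρ, Finset.subset_union_right⟩
      have h1 := (Finset.le_sup' (fun F => extension k (starIdeal k K F)) hF).trans hle
      rw [extension_le_stratumAnn_iff hρ hτ] at h1
      exact h1.mono (Finset.union_subset_union_left Finset.subset_union_left)
    · refine Finset.sup'_le _ _ fun F hF => ?_
      obtain ⟨-, hF, hσF⟩ := Finset.mem_filter.1 hF
      rw [extension_le_stratumAnn_iff hF hσ, Finset.union_eq_left.2 hσF]
      exact hF
  rw [heq]
  exact isSublattice_latticeClosure.1.finsetSup'_mem hT fun F hF =>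
    subset_latticeClosure ⟨F, (Finset.mem_filter.1 hF).2.1, rfl⟩

theorem latticeClosure_eq_isSaturated [IsDomain k] (K : PreAbstractSimplicialComplex V) :
    latticeClosure {I : TwoSidedIdeal (DiffOps k (FaceRing k K)) |
      ∃ σ : Finset V, IsFace K σ ∧ I = extension k (starIdeal k K σ)} =
    {I | I ≠ ⊤ ∧ IsSaturated I} := by
  classical
  apply Set.Subset.antisymm
  · refine latticeClosure_min ?_ ⟨?_, ?_⟩
    · rintro _ ⟨F, hF, rfl⟩
      have hsat := isSaturated_extension_starIdeal (k := k) hF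
      refine ⟨hsat.ne_top_iff.2 ?_, hsat⟩
      rw [extension_le_stratumAnn_iff hF isFace_empty, Finset.union_empty]
      exact hF
    · rintro I ⟨hI, hIs⟩ J ⟨hJ, hJs⟩
      refine ⟨(hIs.sup hJs).ne_top_iff.2 ?_, hIs.sup hJs⟩
      exact sup_le (hIs.ne_top_iff.1 hI) (hJs.ne_top_iff.1 hJ)
    · rintro I ⟨hI, hIs⟩ J ⟨-, hJs⟩
      refine ⟨fun h => hI (top_le_iff.1 (h ▸ inf_le_left)), hIs.inf hJs⟩
  · rintro I ⟨hI, hIs⟩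
    set T : Finset (Finset V) :=
      Finset.univ.filter fun σ => IsFace K σ ∧ I ≤ stratumAnn k K σ
    -- Properness enters here: it puts ∅ in the index set, so the intersection is nonempty and stays
    -- in the lattice.
    have hT : T.Nonempty :=
      ⟨∅, Finset.mem_filter.2 ⟨Finset.mem_univ _, isFace_empty, hIs.ne_top_iff.1 hI⟩⟩
    have heq : I = T.inf' hT fun σ => stratumAnn k K σ := by
      apply le_antisymm
      · exact Finset.le_inf' _ _ fun σ hσ => (Finset.mem_filter.1 hσ).2.2
      · intro φ hφ
        refine hIs.mem fun σ hσ hle => ?_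
        exact Finset.inf'_le (fun σ => stratumAnn k K σ)
          (Finset.mem_filter.2 ⟨Finset.mem_univ _, hσ, hle⟩ : σ ∈ T) hφ
    rw [heq]
    exact isSublattice_latticeClosure.2.finsetInf'_mem hT fun σ hσ =>
      stratumAnn_mem_latticeClosure (Finset.mem_filter.1 hσ).2.1

end Lattice

end StanleyReisner

theorem mainTheorem3 {k : Type*} [CommRing k] [IsDomain k]
    {V : Type*} [Finite V] [DecidableEq V] (K : PreAbstractSimplicialComplex V) :
    (IsField k →
      latticeClosure {I : TwoSidedIdeal (DiffOps k (FaceRing k K)) |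
          ∃ σ : Finset V, IsFace K σ ∧ I = extension k (starIdeal k K σ)} =
        {I | I ≠ ⊤}) ∧
    latticeClosure {I : TwoSidedIdeal (DiffOps k (FaceRing k K)) |
        ∃ σ : Finset V, IsFace K σ ∧ I = extension k (starIdeal k K σ)} =
      {I | I ≠ ⊤ ∧ ∀ (c : k) (φ : DiffOps k (FaceRing k K)), c ≠ 0 → c • φ ∈ I → φ ∈ I} := by
  cases nonempty_fintype V
  have h := latticeClosure_eq_isSaturated (k := k) K
  simp only [isSaturated_iff] at h
  refine ⟨fun hk => ?_, h⟩
  rw [h]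
  ext I
  refine ⟨fun hI => hI.1, fun hI => ⟨hI, fun c φ hc hφ => ?_⟩⟩
  obtain ⟨d, hd⟩ := hk.mul_inv_cancel hc
  have := smul_mem_twoSidedIdeal d hφ
  rwa [smul_smul, mul_comm, hd, one_smul] at this
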